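/- Let $n\in\mathbb N$ and let $\mathcal A=(a_{kl})_{k,l\ge1}\in\mathcal M(n,\infty)$, i.e. $\mathcal A$ is a real symmetric semi-infinite matrix with $a_{kl}=0$ for $|k-l|>n$ whose diagonals $d^{(i)}_k:=a_{k,k+i}$ satisfy the following: there are an integer $0\le j_0\le n-1$ and integers $1<m_1<\dots<m_{j_0}$ such that, with $m_0=0$ and $m_{j_0+1}=\infty$, for $j=0,\dots,j_0$ one has $d^{(n-j)}_k>0$ for $m_j<k<m_{j+1}$ and $d^{(n-j)}_k=0$ for all finite $k\ge m_{j+1}$. Let $\mathscr T$ be a real upper triangular $n\times n$ matrix with nonzero diagonal entries. The $n$-dimensional vector polynomials $\boldsymbol p_k$ ($k\ge1$) are determined by $\boldsymbol p_k=\mathscr T\boldsymbol e_k$ for $k\le n$ (where $\boldsymbol e_1,\dots,\boldsymbol e_n$ is the canonical basis of $\mathbb C^n$) and by $\sum_{l}a_{kl}\boldsymbol p_l(z)=z\boldsymbol p_k(z)$ for all $k\notin\{m_1,\dots,m_{j_0}\}$; put $\boldsymbol q_j(z)=z\boldsymbol p_{m_j}(z)-\sum_l a_{m_jl}\boldsymbol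 p_l(z)$ for $j=1,\dots,j_0$. A nondecreasing (Hermitian) $n\times n$ matrix-valued function $\sigma$ on $\mathbb R$ with finite moments and invertible $\int_{\mathbb R}d\sigma$ is a spectral function of $\mathcal A$ if, for some such $\mathscr T$, the $\boldsymbol p_k$ are orthonormal in $L_2(\mathbb R,\sigma)$, whose inner product is $\int_{\mathbb R}\langle \boldsymbol f,d\sigma\,\boldsymbol g\rangle$, and every $\boldsymbol q_j$ has zero norm in $L_2(\mathbb R,\sigma)$. For $N>n$ let $u_1,\dots,u_N$ be an orthonormal basis of $\mathbb C^N$ consisting of eigenvectors, with eigenvalues $x_1,\dots,x_N$, of the upper-left $N\times N$ corner of $\mathcal A$. There are unique $\alpha_j(x_l)\in\mathbb C$ such that $(u_l)_k=\sum_{j=1}^n\alpha_j(x_l)\,(\boldsymbol p_k(x_l))_j$ for all $k\le N$, and one puts $$\sigma_N^{\mathscr T}(t)=\sum_{x_l<t}\big(\overline{\alpha_a(x_l)}\,\alpha_b(x_l)\big)_{a,b=1}^n .$$ Then $\mathcal A$ has at least one spectral function. More precisely, for every such $\mathscr T$ some subsequence $\sigma_{N_i}^{\mathscr T}$ converges pointwise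 on $\mathbb R$ to a nondecreasing matrix-valued function $\sigma^{\mathscr T}$, and $\sigma^{\mathscr T}$ is a spectral function of $\mathcal A$, the defining conditions being satisfied with this same $\mathscr T$. -/

import Mathlib

open Filter Topology MeasureTheory Polynomial
open scoped ComplexConjugate ComplexOrder

/-- The class `𝓜(n,∞)` of semi-infinite real symmetric band matrices with `2n+1` band diagonals.
Rows and columns are numbered from `0`, so `entry k (k + i)` is the `(k+1)`-st element `d_{k+1}^{(i)}`
of the `i`-th diagonal `𝓓_i`, and `deg j` (`j = 0, …, numDeg - 1`) is `m_{j+1} - 1`,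
where `m_1 < m_2 < ⋯ < m_{j₀}` are the places of the degenerations and `j₀ = numDeg`. -/
structure BandMatrix (n : ℕ) where
  /-- the entries of the matrix -/
  entry : Matrix ℕ ℕ ℝ
  /-- the number `j₀` of degenerations -/
  numDeg : ℕ
  /-- the (zero-based) rows at which the degenerations take place -/
  deg : Fin numDeg → ℕ
  symm : entry.IsSymm
  band : ∀ k l, k + n < l → entry k l = 0
  numDeg_lt : numDeg < n
  /-- `m_1 > 1` -/
  deg_pos : ∀ i, 0 < deg i
  deg_strictMono : StrictMono deg
  /-- `d_k^{(n-j)} > 0` for `m_j < k < m_{j+1}` and `0 ≤ j ≤ j₀`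
  (with `m_0 = 0` and `m_{j₀+1} = ∞`) -/
  diag_pos : ∀ j ≤ numDeg, ∀ k,
    (∀ i : Fin numDeg, (i : ℕ) < j → deg i < k) →
    (∀ i : Fin numDeg, j ≤ (i : ℕ) → k < deg i) →
    0 < entry k (k + (n - j))
  /-- `d_k^{(n-j)} = 0` for `k ≥ m_{j+1}` and `0 ≤ j < j₀` -/
  diag_zero : ∀ (i : Fin numDeg) (k : ℕ), deg i ≤ k → entry k (k + (n - i)) = 0

/-- The admissible matrices of initial data: real, upper triangular, with nonzero diagonal. -/
def IsInitialMatrix {n : ℕ} (T : Matrix (Fin n) (Fin n) ℝ) : Prop :=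
  (∀ i j, j < i → T i j = 0) ∧ ∏ i, T i i ≠ 0

namespace BandMatrix

variable {n : ℕ}

/-- For a sequence `p` of `n`-dimensional vector polynomials, the vector polynomial
`z p_k(z) - ∑_l a_{kl} p_l(z)`. The sum is finite, since `a_{kl} = 0` for `l > k + n`. -/
noncomputable def rowResidual (A : BandMatrix n) (p : ℕ → Fin n → ℂ[X]) (k : ℕ) : Fin n → ℂ[X] :=
  fun i => X * p k i - ∑ l ∈ Finset.range (k + n + 1), C (A.entry k l : ℂ) * p l i

/-- `p` is the sequence `{𝒑_k}` of vector polynomials of `A` with initial data `T`: the first `n` of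
them are the columns `T e_k` of `T`, and the equation `∑_l a_{kl} 𝒑_l(z) = z 𝒑_k(z)` holds in every
row `k` in which no degeneration takes place. -/
def IsVectorPolynomialSequence (A : BandMatrix n) (T : Matrix (Fin n) (Fin n) ℝ)
    (p : ℕ → Fin n → ℂ[X]) : Prop :=
  (∀ k i : Fin n, p k i = C (T i k : ℂ)) ∧
    ∀ k : ℕ, k ∉ Set.range A.deg → A.rowResidual p k = 0

/-- The vector polynomial `𝒒_j`: the residual of the equation in the row of the `j`-th degeneration
(in that row the entries beyond the diagonal `𝓓_{n-j}`, `j` counted from one, vanish). -/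
noncomputable def q (A : BandMatrix n) (p : ℕ → Fin n → ℂ[X]) (j : Fin A.numDeg) : Fin n → ℂ[X] :=
  A.rowResidual p (A.deg j)

/-- `s` is the spectral function `σ_N^𝒯` of the `N × N` upper-left corner of `A`, where `p` is the
sequence of vector polynomials of `A` with initial data `𝒯`. There is an orthonormal basis `u_l` of
eigenvectors, with eigenvalues `x_l`; they decompose as `u_l = ∑_j α_j(x_l) φ^{(j)}(x_l)`, where
`φ^{(j)}_k(z)` is the `j`-th component of `𝒑_k(z)`; and `s(t)` is the sum over `x_l < t` of the
matrices with `(a, b)` entry `conj α_a(x_l) * α_b(x_l)`. -/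
def IsSectionSpectralFunction (A : BandMatrix n) (p : ℕ → Fin n → ℂ[X]) (N : ℕ)
    (s : ℝ → Matrix (Fin n) (Fin n) ℂ) : Prop :=
  ∃ (u : OrthonormalBasis (Fin N) ℂ (EuclideanSpace ℂ (Fin N))) (x : Fin N → ℝ)
    (α : Fin N → Fin n → ℂ),
    (∀ l k : Fin N, ∑ r : Fin N, (A.entry k r : ℂ) * u l r = (x l : ℂ) * u l k) ∧
    (∀ l k : Fin N, u l k = ∑ j, α l j * (p k j).eval (x l : ℂ)) ∧
    ∀ t : ℝ, s t = ∑ l with x l < t, Matrix.of fun a b => conj (α l a) * α l b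

end BandMatrix

/-- A nondecreasing function on `ℝ` whose values are Hermitian `n × n` matrices. -/
structure MonotoneMatrixFunction (n : ℕ) where
  toFun : ℝ → Matrix (Fin n) (Fin n) ℂ
  isHermitian : ∀ t, (toFun t).IsHermitian
  nondecreasing : ∀ s t, s ≤ t → (toFun t - toFun s).PosSemidef

namespace MonotoneMatrixFunction

variable {n : ℕ}

/-- The real function `t ↦ ⟨v, σ(t) v⟩`. -/
def quadForm (σ : MonotoneMatrixFunction n) (v : Fin n → ℂ) (t : ℝ) : ℝ :=
  (star v ⬝ᵥ (σ.toFun t).mulVec v).re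

theorem monotone_quadForm (σ : MonotoneMatrixFunction n) (v : Fin n → ℂ) :
    Monotone (σ.quadForm v) := by
  intro s t hst
  have h := (σ.nondecreasing s t hst).dotProduct_mulVec_nonneg v
  rw [Matrix.sub_mulVec, dotProduct_sub, Complex.le_def] at h
  simpa [quadForm] using h.1

/-- The Lebesgue–Stieltjes measure `⟨v, dσ v⟩`. -/
noncomputable def quadMeasure (σ : MonotoneMatrixFunction n) (v : Fin n → ℂ) : Measure ℝ :=
  (σ.monotone_quadForm v).stieltjesFunction.measure

/-- The integral `∫ f dσ_{ij}` with respect to the `(i, j)` entry of `dσ`, which is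
`¼ ∑_{r<4} (-i)^r ⟨v_r, dσ v_r⟩` with `v_r = e_i + i^r e_j`, by polarization. -/
noncomputable def entryIntegral (σ : MonotoneMatrixFunction n) (i j : Fin n) (f : ℝ → ℂ) : ℂ :=
  (1 / 4 : ℂ) * ∑ r : Fin 4, (-Complex.I) ^ (r : ℕ) *
    ∫ t, f t ∂(σ.quadMeasure (Pi.single i 1 + Complex.I ^ (r : ℕ) • Pi.single j 1))

/-- All moments of `σ` are finite: `t^k` is absolutely integrable with respect to `⟨v, dσ v⟩`
for all `k` and `v` (hence with respect to every entry of `dσ`). -/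
def HasFiniteMoments (σ : MonotoneMatrixFunction n) : Prop :=
  ∀ (k : ℕ) (v : Fin n → ℂ), Integrable (fun t : ℝ => t ^ k) (σ.quadMeasure v)

/-- The matrix moment `∫ t^k dσ(t)`. -/
noncomputable def moment (σ : MonotoneMatrixFunction n) (k : ℕ) : Matrix (Fin n) (Fin n) ℂ :=
  Matrix.of fun i j => σ.entryIntegral i j fun t => (t : ℂ) ^ k

/-- The inner product `∫ ⟨f, dσ g⟩ = ∑_{i,j} ∫ conj f_i(t) * g_j(t) dσ_{ij}(t)` of `L₂(ℝ,σ)`,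
antilinear in the first argument, on vector polynomials. -/
noncomputable def polyInner (σ : MonotoneMatrixFunction n) (f g : Fin n → ℂ[X]) : ℂ :=
  ∑ i, ∑ j, σ.entryIntegral i j fun t => conj ((f i).eval (t : ℂ)) * (g j).eval (t : ℂ)

end MonotoneMatrixFunction

namespace BandMatrix

variable {n : ℕ}

/-- The conditions on `σ` in the definition of a spectral function of `A`, for a given sequence `p`
of vector polynomials of `A`: finite moments, invertible `∫ dσ`, the `𝒑_k` are orthonormal in
`L₂(ℝ,σ)`, and every `𝒒_j` has zero norm there. -/
structure IsSpectralFunctionFor (A : BandMatrix n) (p : ℕ → Fin n → ℂ[X])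
    (σ : MonotoneMatrixFunction n) : Prop where
  finiteMoments : σ.HasFiniteMoments
  isUnit_moment_zero : IsUnit (σ.moment 0)
  orthonormal : ∀ j k, σ.polyInner (p j) (p k) = if j = k then 1 else 0
  q_eq_zero : ∀ j, σ.polyInner (A.q p j) (A.q p j) = 0

/-- `σ` is a spectral function of `A`. -/
def IsSpectralFunction (A : BandMatrix n) (σ : MonotoneMatrixFunction n) : Prop :=
  ∃ T : Matrix (Fin n) (Fin n) ℝ, IsInitialMatrix T ∧
    ∃ p : ℕ → Fin n → ℂ[X], A.IsVectorPolynomialSequence T p ∧ A.IsSpectralFunctionFor p σ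

end BandMatrix

/-!
The corner of size `N` is a Hermitian matrix, and an eigenvector of it solves the recurrence of the
regular rows, hence is a combination `(u_l)_k = ∑_a α_a (𝒑_k(x_l))_a` of the components of the
vector polynomials (`eq_sum_eval_of_recurrence`). The map `f ↦ (∑_a α_a f_a(x_l))_l` therefore carries the
inner product of `L₂(σ_N)` to that of `ℂ^N`, sends `𝒑_k` to the `k`-th coordinates of the
eigenvectors, and sends `𝒒_j` to zero as soon as its row fits in the corner. So the `𝒑_k` with
`k < N` are orthonormal for `σ_N`.

It remains to pass to the limit. Helly's theorem (`exists_subseq_tendsto_of_monotone`), applied to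
the finitely many quadratic forms that determine a matrix by polarization, gives a subsequence which
converges at every point. Multiplication by the eigenvalue acts on the coordinates of `u_l` as the
band matrix, so `x_l^k α_a` is a combination of the first `n + k n` coordinates with coefficients
independent of `N` (`exists_pow_mul_α_eq`); by completeness of the eigenbasis the `k`-th moment of
`σ_N` is the same for all `N > n + k n`. Bounded moments of all orders prevent any loss of mass or
of moments at infinity, so the moments of the Lebesgue–Stieltjes measures of the limit are the limits
of the moments (`tendsto_moment_stieltjes`), and the algebraic relations persist. In particular
`Tᵀ (∫ dσ) T = 1`, which shows that `∫ dσ` is invertible.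
-/

/-! ### Helly's selection theorem -/

/-- Helly's selection theorem for finitely (or countably) many sequences of uniformly bounded
monotone functions on `ℝ`: a common subsequence converges at every point of `ℝ`. -/
theorem exists_subseq_tendsto_of_monotone {ι : Type*} [Countable ι] (F : ℕ → ι → ℝ → ℝ)
    (hF : ∀ N i, Monotone (F N i)) (C : ℝ) (hC : ∀ N i t, F N i t ∈ Set.Icc 0 C) :
    ∃ (φ : ℕ → ℕ) (G : ι → ℝ → ℝ), StrictMono φ ∧
      ∀ i t, Tendsto (fun k => F (φ k) i t) atTop (𝓝 (G i t)) := by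
  -- The whole sequence has a cluster point `G` in the compact, not first countable, product.
  have hcpt : IsCompact (Set.univ.pi fun _ : ι × ℝ => Set.Icc (0 : ℝ) C) :=
    isCompact_univ_pi fun _ => isCompact_Icc
  obtain ⟨G, -, hG⟩ := hcpt.exists_mapClusterPt (f := atTop)
    (u := fun N (x : ι × ℝ) => F N x.1 x.2) (by
      rw [le_principal_iff, mem_map]
      exact univ_mem' fun N x _ => hC N x.1 x.2)
  have hmono : ∀ i, Monotone fun t => G (i, t) := by
    intro i s t hst
    have hcl : IsClosed {g : ι × ℝ → ℝ | g (i, s) ≤ g (i, t)} :=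
      isClosed_le (continuous_apply _) (continuous_apply _)
    exact hcl.mem_of_mapClusterPt hG (Eventually.of_forall fun N => hF N i hst)
  -- On the rationals and the points of discontinuity, a subsequence converges to `G`.
  set D : Set (ι × ℝ) := (Set.range fun x : ι × ℚ => (x.1, (x.2 : ℝ))) ∪
    ⋃ i, (fun t => (i, t)) '' {t | ¬ ContinuousAt (fun t => G (i, t)) t} with hD
  have hDc : D.Countable := (Set.countable_range _).union
    (Set.countable_iUnion fun i => ((hmono i).countable_not_continuousAt).image _)
  have : Countable D := hDc
  have hres : Continuous fun (g : ι × ℝ → ℝ) (x : D) => g x.1 :=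
    continuous_pi fun x => continuous_apply _
  obtain ⟨φ, hφ, hlim⟩ := (hG.continuousAt_comp hres.continuousAt).tendsto_subseq
  have hlim' : ∀ x ∈ D, Tendsto (fun k => F (φ k) x.1 x.2) atTop (𝓝 (G x)) := fun x hx =>
    (tendsto_pi_nhds.1 hlim) ⟨x, hx⟩
  have hq : ∀ (i : ι) (q : ℚ), Tendsto (fun k => F (φ k) i q) atTop (𝓝 (G (i, q))) :=
    fun i q => hlim' (i, q) (Or.inl ⟨(i, q), rfl⟩)
  refine ⟨φ, fun i t => G (i, t), hφ, fun i t => ?_⟩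
  by_cases hc : ContinuousAt (fun t => G (i, t)) t
  · refine tendsto_order.2 ⟨fun a ha => ?_, fun a ha => ?_⟩
    · obtain ⟨l, u, hlu, hsub⟩ := mem_nhds_iff_exists_Ioo_subset.1
        (hc.eventually (lt_mem_nhds ha))
      obtain ⟨q, hlq, hqt⟩ := exists_rat_btwn hlu.1
      filter_upwards [(hq i q).eventually (lt_mem_nhds (hsub ⟨hlq, hqt.trans hlu.2⟩))] with k hk
      exact hk.trans_le (hF _ i hqt.le)
    · obtain ⟨l, u, hlu, hsub⟩ := mem_nhds_iff_exists_Ioo_subset.1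
        (hc.eventually (gt_mem_nhds ha))
      obtain ⟨q, htq, hqu⟩ := exists_rat_btwn hlu.2
      filter_upwards [(hq i q).eventually (gt_mem_nhds (hsub ⟨hlu.1.trans htq, hqu⟩))] with k hk
      exact (hF _ i htq.le).trans_lt hk
  · exact hlim' (i, t) (Or.inr (Set.mem_iUnion.2 ⟨i, t, hc, rfl⟩))

/-! ### Convergence of moments -/

/-- Markov's inequality for the tails of a measure on `ℝ`, in terms of `∫ (1 + x²)^k`. -/
theorem measure_le_abs_mul_le_lintegral (μ : Measure ℝ) (k : ℕ) {t : ℝ} (ht : 0 ≤ t) :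
    μ {x | t ≤ |x|} * ENNReal.ofReal ((1 + t ^ 2) ^ k) ≤
      ∫⁻ x, ENNReal.ofReal ((1 + x ^ 2) ^ k) ∂μ := by
  rw [mul_comm]
  refine le_trans ?_ (mul_meas_ge_le_lintegral (by fun_prop) (ENNReal.ofReal ((1 + t ^ 2) ^ k)))
  refine mul_le_mul_right (measure_mono fun x hx => ?_) _
  have h : t ^ 2 ≤ x ^ 2 := by
    rw [← sq_abs x]
    exact pow_le_pow_left₀ ht hx 2
  exact ENNReal.ofReal_le_ofReal (pow_le_pow_left₀ (by positivity) (by linarith) k)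

/-- If the tails of measures with uniformly bounded moments converge for almost every threshold,
then so do the moments of positive order, by the layer-cake formula and dominated convergence. -/
theorem tendsto_integral_pow_of_tail {μ : ℕ → Measure ℝ} {ν : Measure ℝ}
    (hC : ∀ k : ℕ, ∃ C : ENNReal, C ≠ ⊤ ∧
      ∀ᶠ N in atTop, ∫⁻ x, ENNReal.ofReal ((1 + x ^ 2) ^ k) ∂μ N ≤ C)
    {f : ℝ → ℝ} (hf : Measurable f) (hf0 : ∀ x, 0 ≤ f x) (hfle : ∀ x, f x ≤ |x|)
    (htail : ∀ᵐ t : ℝ, 0 < t →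
      Tendsto (fun N => μ N {x | t < f x}) atTop (𝓝 (ν {x | t < f x}))) (j : ℕ) :
    (∀ᶠ N in atTop, Integrable (fun x => f x ^ (j + 1)) (μ N)) ∧
      Integrable (fun x => f x ^ (j + 1)) ν ∧
      Tendsto (fun N => ∫ x, f x ^ (j + 1) ∂μ N) atTop (𝓝 (∫ x, f x ^ (j + 1) ∂ν)) := by
  obtain ⟨C, hCtop, hC⟩ := hC (j + 1)
  have layer : ∀ ρ : Measure ℝ, ∫⁻ x, ENNReal.ofReal (f x ^ (j + 1)) ∂ρ =
      ENNReal.ofReal (j + 1) *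
        ∫⁻ t in Set.Ioi (0 : ℝ), ρ {x | t < f x} * ENNReal.ofReal (t ^ j) := by
    intro ρ
    have h := lintegral_rpow_eq_lintegral_meas_lt_mul ρ (Eventually.of_forall hf0) hf.aemeasurable
      (p := (j : ℝ) + 1) (by positivity)
    have h1 : ∀ y : ℝ, y ^ ((j : ℝ) + 1) = y ^ (j + 1) := fun y => by
      exact_mod_cast Real.rpow_natCast y (j + 1)
    simpa only [h1, add_sub_cancel_right, Real.rpow_natCast] using h
  have hlim : Tendsto (fun N => ∫⁻ x, ENNReal.ofReal (f x ^ (j + 1)) ∂μ N) atTop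
      (𝓝 (∫⁻ x, ENNReal.ofReal (f x ^ (j + 1)) ∂ν)) := by
    simp only [layer]
    refine ENNReal.Tendsto.const_mul ?_ (Or.inr ENNReal.ofReal_ne_top)
    refine tendsto_lintegral_filter_of_dominated_convergence
      (fun t => C * ENNReal.ofReal ((1 + t ^ 2)⁻¹)) ?_ ?_ ?_ ?_
    · refine Eventually.of_forall fun N => Measurable.mul ?_ (by fun_prop)
      exact Antitone.measurable fun s t hst => measure_mono fun x (hx : t < f x) =>
        lt_of_le_of_lt hst hx
    · filter_upwards [hC] with N hN
      refine (ae_restrict_iff' measurableSet_Ioi).2 (Eventually.of_forall fun t ht => ?_)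
      have ht : (0 : ℝ) < t := ht
      have h1 : μ N {x | t < f x} * ENNReal.ofReal ((1 + t ^ 2) ^ (j + 1)) ≤ C := by
        refine le_trans ?_ ((measure_le_abs_mul_le_lintegral (μ N) (j + 1) ht.le).trans hN)
        exact mul_le_mul_left (measure_mono fun x hx =>
          (show t < f x from hx).le.trans (hfle x)) _
      have h2 : t ^ j ≤ (1 + t ^ 2) ^ (j + 1) * (1 + t ^ 2)⁻¹ := by
        rw [pow_succ, mul_assoc, mul_inv_cancel₀ (by positivity), mul_one]
        exact pow_le_pow_left₀ ht.le (by nlinarith [sq_nonneg (t - 1)]) j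
      calc μ N {x | t < f x} * ENNReal.ofReal (t ^ j)
          ≤ μ N {x | t < f x} * (ENNReal.ofReal ((1 + t ^ 2) ^ (j + 1)) *
              ENNReal.ofReal ((1 + t ^ 2)⁻¹)) := by
            rw [← ENNReal.ofReal_mul (by positivity)]
            gcongr
        _ ≤ C * ENNReal.ofReal ((1 + t ^ 2)⁻¹) := by
            rw [← mul_assoc]
            gcongr
    · rw [lintegral_const_mul _ (by fun_prop)]
      refine ENNReal.mul_ne_top hCtop ?_
      exact (integrable_inv_one_add_sq.restrict (s := Set.Ioi (0 : ℝ))).lintegral_lt_top.ne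
    · refine (ae_restrict_iff' measurableSet_Ioi).2 ?_
      filter_upwards [htail] with t h ht
      exact ENNReal.Tendsto.mul_const (h ht) (Or.inr ENNReal.ofReal_ne_top)
  have hbound : ∀ᶠ N in atTop, ∫⁻ x, ENNReal.ofReal (f x ^ (j + 1)) ∂μ N ≤ C := by
    filter_upwards [hC] with N hN
    refine (lintegral_mono fun x => ENNReal.ofReal_le_ofReal ?_).trans hN
    refine pow_le_pow_left₀ (hf0 x) ((hfle x).trans ?_) _
    nlinarith [sq_nonneg (|x| - 1), sq_abs x]
  have hνC : ∫⁻ x, ENNReal.ofReal (f x ^ (j + 1)) ∂ν ≤ C := le_of_tendsto hlim hbound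
  have hint : ∀ ρ : Measure ℝ, ∫⁻ x, ENNReal.ofReal (f x ^ (j + 1)) ∂ρ ≤ C →
      Integrable (fun x => f x ^ (j + 1)) ρ := by
    intro ρ h
    refine (lintegral_ofReal_ne_top_iff_integrable (hf.pow_const _).aestronglyMeasurable
      (Eventually.of_forall fun x => pow_nonneg (hf0 x) _)).1 (h.trans_lt hCtop.lt_top).ne
  have heq : ∀ ρ : Measure ℝ, ∫ x, f x ^ (j + 1) ∂ρ =
      (∫⁻ x, ENNReal.ofReal (f x ^ (j + 1)) ∂ρ).toReal := fun ρ =>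
    integral_eq_lintegral_of_nonneg_ae (Eventually.of_forall fun x => pow_nonneg (hf0 x) _)
      (hf.pow_const _).aestronglyMeasurable
  refine ⟨hbound.mono fun N => hint _, hint _ hνC, ?_⟩
  simp only [heq]
  exact (ENNReal.tendsto_toReal (hνC.trans_lt hCtop.lt_top).ne).comp hlim

theorem Monotone.leftLim_rightLim_of_continuousAt {F : ℝ → ℝ} (hF : Monotone F) {t : ℝ}
    (ht : ContinuousAt F t) :
    Function.leftLim (Function.rightLim F) t = F t := by
  refine leftLim_eq_of_tendsto ?_
  refine tendsto_of_tendsto_of_tendsto_of_le_of_le' (ht.mono_left nhdsWithin_le_nhds)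
    tendsto_const_nhds (Eventually.of_forall fun s => hF.le_rightLim le_rfl) ?_
  filter_upwards [self_mem_nhdsWithin] with s hs
  exact hF.rightLim_le hs

/-- Let finite measures on `ℝ` of the same mass `m` have uniformly bounded moments, and let their
distribution functions converge pointwise to `F`. Then their moments converge to those of the
Lebesgue–Stieltjes measure of `F`; no mass and no moment escapes to infinity. -/
theorem tendsto_moment_stieltjes {μ : ℕ → Measure ℝ} {F : ℝ → ℝ} (hF : Monotone F)
    (hF0 : ∀ t, 0 ≤ F t)
    (hlim : ∀ t, Tendsto (fun N => μ N (Set.Iio t)) atTop (𝓝 (ENNReal.ofReal (F t))))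
    {m : ℝ} (hm : 0 ≤ m) (hmass : ∀ N, μ N Set.univ = ENNReal.ofReal m)
    (hC : ∀ k : ℕ, ∃ C : ENNReal, C ≠ ⊤ ∧
      ∀ᶠ N in atTop, ∫⁻ x, ENNReal.ofReal ((1 + x ^ 2) ^ k) ∂μ N ≤ C) (k : ℕ) :
    Integrable (fun x => x ^ k) hF.stieltjesFunction.measure ∧
      Tendsto (fun N => ∫ x, x ^ k ∂μ N) atTop
        (𝓝 (∫ x, x ^ k ∂hF.stieltjesFunction.measure)) := by
  set ν := hF.stieltjesFunction.measure with hν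
  have hIci : ∀ t, Tendsto (fun N => μ N (Set.Ici t)) atTop
      (𝓝 (ENNReal.ofReal (m - F t))) := by
    intro t
    have h1 : ∀ N, μ N (Set.Ici t) = ENNReal.ofReal m - μ N (Set.Iio t) := by
      intro N
      have hfin : μ N (Set.Iio t) ≠ ⊤ :=
        ((measure_mono (Set.subset_univ _)).trans_lt
          (by rw [hmass]; exact ENNReal.ofReal_lt_top)).ne
      rw [← Set.compl_Iio, measure_compl measurableSet_Iio hfin, hmass]
    simp only [h1]
    rw [ENNReal.ofReal_sub _ (hF0 t)]
    exact ENNReal.Tendsto.sub tendsto_const_nhds (hlim t) (Or.inl ENNReal.ofReal_ne_top)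
  have hFm : ∀ t, F t ≤ m := by
    intro t
    refine (ENNReal.ofReal_le_ofReal_iff hm).1 (le_of_tendsto (hlim t) ?_)
    exact Eventually.of_forall fun N => (measure_mono (Set.subset_univ _)).trans_eq (hmass N)
  obtain ⟨C, hCtop, hC1⟩ := hC 1
  -- Chebyshev's inequality passes to the limit and gives the limits of `F` at `±∞`.
  have key : ∀ (y s : ℝ) (B : Set ℝ), 0 ≤ y → B ⊆ {x | |s| ≤ |x|} →
      Tendsto (fun N => μ N B) atTop (𝓝 (ENNReal.ofReal y)) → y ≤ C.toReal * (1 + s ^ 2)⁻¹ := by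
    intro y s B hy hB hlimB
    have h1 : ENNReal.ofReal y * ENNReal.ofReal ((1 + s ^ 2)) ≤ C := by
      refine le_of_tendsto (ENNReal.Tendsto.mul_const hlimB (Or.inr ENNReal.ofReal_ne_top)) ?_
      filter_upwards [hC1] with N hN
      refine le_trans ?_ ((measure_le_abs_mul_le_lintegral (μ N) 1 (abs_nonneg s)).trans hN)
      rw [pow_one, sq_abs]
      gcongr
    rw [← ENNReal.ofReal_mul hy] at h1
    have h2 := (ENNReal.ofReal_le_iff_le_toReal hCtop).1 h1
    rwa [← div_eq_mul_inv, le_div_iff₀ (by positivity)]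
  have hsq : ∀ l : Filter ℝ, Tendsto (fun x : ℝ => |x|) l atTop →
      Tendsto (fun s : ℝ => C.toReal * (1 + s ^ 2)⁻¹) l (𝓝 0) := by
    intro l hl
    have h1 : Tendsto (fun s : ℝ => 1 + s ^ 2) l atTop := by
      refine tendsto_atTop_add_const_left _ _ ?_
      simpa only [sq_abs, Function.comp_def] using
        (tendsto_pow_atTop (α := ℝ) two_ne_zero).comp hl
    simpa using h1.inv_tendsto_atTop.const_mul C.toReal
  have hbot : Tendsto F atBot (𝓝 0) := by
    refine tendsto_of_tendsto_of_tendsto_of_le_of_le' tendsto_const_nhds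
      (hsq _ tendsto_abs_atBot_atTop) (Eventually.of_forall hF0) ?_
    filter_upwards [eventually_le_atBot 0] with t ht
    refine key _ t (Set.Iio t) (hF0 t) (fun x hx => ?_) (hlim t)
    have hx : x < t := hx
    change |t| ≤ |x|
    rw [abs_of_nonpos ht, abs_of_nonpos (hx.le.trans ht)]
    linarith
  have htop' : Tendsto (fun t => m - F t) atTop (𝓝 0) := by
    refine tendsto_of_tendsto_of_tendsto_of_le_of_le' tendsto_const_nhds
      (hsq _ tendsto_abs_atTop_atTop) (Eventually.of_forall fun t => sub_nonneg.2 (hFm t)) ?_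
    filter_upwards [eventually_ge_atTop 0] with t ht
    refine key _ t (Set.Ici t) (sub_nonneg.2 (hFm t)) (fun x hx => ?_) (hIci t)
    have hx : t ≤ x := hx
    change |t| ≤ |x|
    rwa [abs_of_nonneg ht, abs_of_nonneg (ht.trans hx)]
  have htop : Tendsto F atTop (𝓝 m) := by
    simpa using htop'.const_sub m
  have hs_atBot : Tendsto hF.stieltjesFunction atBot (𝓝 0) := by
    refine tendsto_of_tendsto_of_tendsto_of_le_of_le hbot
      (hbot.comp (tendsto_atBot_add_const_right _ (1 : ℝ) tendsto_id))
      (fun s => hF.le_rightLim le_rfl) (fun s => hF.rightLim_le (lt_add_one s))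
  have hs_atTop : Tendsto hF.stieltjesFunction atTop (𝓝 m) := by
    refine tendsto_of_tendsto_of_tendsto_of_le_of_le htop
      (htop.comp (tendsto_atTop_add_const_right _ (1 : ℝ) tendsto_id))
      (fun s => hF.le_rightLim le_rfl) (fun s => hF.rightLim_le (lt_add_one s))
  -- The Stieltjes measure is built from the right limits of `F`, so its tails agree with those of `F`
  -- only at the points of continuity; these are almost all points, which the layer-cake formula needs.
  have hνIio : ∀ t, ContinuousAt F t → ν (Set.Iio t) = ENNReal.ofReal (F t) := by
    intro t ht
    rw [hν, StieltjesFunction.measure_Iio _ hs_atBot, sub_zero]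
    exact congrArg _ (hF.leftLim_rightLim_of_continuousAt ht)
  have hνIci : ∀ t, ContinuousAt F t → ν (Set.Ici t) = ENNReal.ofReal (m - F t) := by
    intro t ht
    rw [hν, StieltjesFunction.measure_Ici _ hs_atTop]
    exact congrArg (fun y => ENNReal.ofReal (m - y)) (hF.leftLim_rightLim_of_continuousAt ht)
  have hcont : ∀ᵐ t : ℝ, ContinuousAt F t :=
    (hF.countable_not_continuousAt.measure_zero volume)
  have hcont' : ∀ᵐ t : ℝ, ContinuousAt F (-t) := by
    have : {t : ℝ | ¬ ContinuousAt F (-t)}.Countable :=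
      hF.countable_not_continuousAt.preimage_of_injOn (f := fun t : ℝ => -t)
        neg_injective.injOn
    exact this.measure_zero volume
  -- For thresholds `t > 0`, the tails of the positive part are the half-lines `[t, ∞)` (up to
  -- countably many `t`), and those of the negative part are the half-lines `(-∞, -t)`.
  have hpos := fun j => tendsto_integral_pow_of_tail (ν := ν) hC (f := fun x => max x 0)
    (by fun_prop) (fun x => le_max_right _ _) (fun x => max_le (le_abs_self x) (abs_nonneg x)) (by
      have h1 : ∀ᵐ t : ℝ, ∀ N, μ N {x | t ≤ max x 0} = μ N {x | t < max x 0} :=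
        ae_all_iff.2 fun N => meas_le_ae_eq_meas_lt (μ N) volume _
      have h2 : ∀ᵐ t : ℝ, ν {x | t ≤ max x 0} = ν {x | t < max x 0} :=
        meas_le_ae_eq_meas_lt ν volume _
      filter_upwards [hcont, h1, h2] with t hct h1 h2 ht
      have hset : {x : ℝ | t ≤ max x 0} = Set.Ici t := by
        ext x
        simp [ht]
      simp only [← h1, ← h2, hset, hνIci t hct]
      exact hIci t) j
  have hneg := fun j => tendsto_integral_pow_of_tail (ν := ν) hC (f := fun x => max (-x) 0)
    (by fun_prop) (fun x => le_max_right _ _) (fun x => max_le (neg_le_abs x) (abs_nonneg x)) (by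
      filter_upwards [hcont'] with t hct ht
      have hset : {x : ℝ | t < max (-x) 0} = Set.Iio (-t) := by
        ext x
        simp [ht.le, lt_neg]
      simp only [hset, hνIio _ hct]
      exact hlim (-t)) j
  rcases k with _ | j
  · have hνuniv : ν Set.univ = ENNReal.ofReal m := by
      rw [hν, StieltjesFunction.measure_univ _ hs_atBot hs_atTop, sub_zero]
    have : IsFiniteMeasure ν := ⟨by rw [hνuniv]; exact ENNReal.ofReal_lt_top⟩
    refine ⟨by simp, ?_⟩
    simp [Measure.real, hmass, hνuniv]
  · have hsplit : (fun x : ℝ => x ^ (j + 1)) = fun x =>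
        max x 0 ^ (j + 1) + (-1) ^ (j + 1) * max (-x) 0 ^ (j + 1) := by
      funext x
      rcases le_total 0 x with hx | hx
      · simp [max_eq_left hx, max_eq_right (neg_nonpos.2 hx)]
      · rw [max_eq_right hx, max_eq_left (neg_nonneg.2 hx), ← mul_pow]
        simp
    rw [hsplit]
    obtain ⟨hp1, hp2, hp3⟩ := hpos j
    obtain ⟨hn1, hn2, hn3⟩ := hneg j
    refine ⟨hp2.add (hn2.const_mul _), ?_⟩
    rw [integral_add hp2 (hn2.const_mul _), integral_const_mul]
    refine (hp3.add (hn3.const_mul ((-1) ^ (j + 1)))).congr' ?_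
    filter_upwards [hp1, hn1] with N h1 h2
    rw [integral_add h1 (h2.const_mul _), integral_const_mul]

/-! ### The recurrence in the nondegenerate rows -/

namespace BandMatrix

variable {n : ℕ}

/-- The row `k` is regular if no degeneration takes place in it. -/
def IsRegularRow (A : BandMatrix n) (k : ℕ) : Prop := k ∉ Set.range A.deg

noncomputable instance (A : BandMatrix n) : DecidablePred A.IsRegularRow :=
  Classical.decPred _

/-- The number of degenerations above the row `k`. -/
noncomputable def degCount (A : BandMatrix n) (k : ℕ) : ℕ :=
  (Finset.univ.filter fun i => A.deg i < k).card

theorem lt_degCount_iff (A : BandMatrix n) (k : ℕ) (i : Fin A.numDeg) :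
    (i : ℕ) < A.degCount k ↔ A.deg i < k := by
  constructor
  · intro h
    by_contra hk
    have : (Finset.univ.filter fun i => A.deg i < k) ⊆ Finset.Iio i := fun i' hi' =>
      Finset.mem_Iio.2 (A.deg_strictMono.lt_iff_lt.1
        (((Finset.mem_filter.1 hi').2).trans_le (not_lt.1 hk)))
    have := Finset.card_le_card this
    rw [Fin.card_Iio] at this
    exact absurd h (not_lt.2 this)
  · intro h
    have : Finset.Iic i ⊆ (Finset.univ.filter fun i => A.deg i < k) := fun i' hi' =>
      Finset.mem_filter.2 ⟨Finset.mem_univ _,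
        (A.deg_strictMono.monotone (Finset.mem_Iic.1 hi')).trans_lt h⟩
    have := Finset.card_le_card this
    rw [Fin.card_Iic] at this
    exact this

theorem degCount_le (A : BandMatrix n) (k : ℕ) : A.degCount k ≤ A.numDeg :=
  (Finset.card_filter_le _ _).trans_eq (Finset.card_fin _)

theorem count_add_degCount (A : BandMatrix n) (k : ℕ) :
    Nat.count A.IsRegularRow k + A.degCount k = k := by
  have h : (Finset.range k).filter (fun r => ¬ A.IsRegularRow r) =
      (Finset.univ.filter fun i => A.deg i < k).image A.deg := by
    ext r
    simp only [IsRegularRow, not_not, Finset.mem_filter, Finset.mem_range, Set.mem_range,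
      Finset.mem_image, Finset.mem_univ, true_and]
    constructor
    · rintro ⟨hr, i, rfl⟩
      exact ⟨i, hr, rfl⟩
    · rintro ⟨i, hr, rfl⟩
      exact ⟨hr, i, rfl⟩
  rw [Nat.count_eq_card_filter_range, degCount,
    ← Finset.card_image_of_injective _ A.deg_strictMono.injective, ← h,
    Finset.card_filter_add_card_filter_not, Finset.card_range]

/-- The column of the last nonzero entry in a regular row `k`. It equals `k + n - j` with `j` the
number of degenerations above `k`, and is written here as `n` plus the number of regular rows
above `k`, so that `k ↦ lastCol k` visibly numbers the regular rows by the columns `n, n + 1, …`. -/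
noncomputable def lastCol (A : BandMatrix n) (k : ℕ) : ℕ := n + Nat.count A.IsRegularRow k

theorem lastCol_eq (A : BandMatrix n) (k : ℕ) : A.lastCol k = k + (n - A.degCount k) := by
  have h1 := A.count_add_degCount k
  have h2 := A.degCount_le k
  have h3 := A.numDeg_lt
  rw [lastCol]
  omega

theorem lt_lastCol (A : BandMatrix n) (k : ℕ) : k < A.lastCol k := by
  have h2 := A.degCount_le k
  have h3 := A.numDeg_lt
  rw [lastCol_eq]
  omega

theorem lastCol_le (A : BandMatrix n) (k : ℕ) : A.lastCol k ≤ k + n := by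
  rw [lastCol_eq]
  omega

theorem entry_lastCol_pos (A : BandMatrix n) {k : ℕ} (hk : A.IsRegularRow k) :
    0 < A.entry k (A.lastCol k) := by
  rw [lastCol_eq]
  refine A.diag_pos _ (A.degCount_le k) k (fun i hi => (A.lt_degCount_iff k i).1 hi)
    fun i hi => ?_
  have h1 : ¬ A.deg i < k := fun h => absurd ((A.lt_degCount_iff k i).2 h) (not_lt.2 hi)
  exact lt_of_le_of_ne (not_lt.1 h1) fun h => hk ⟨i, h.symm⟩

theorem entry_eq_zero_of_lastCol_lt (A : BandMatrix n) {k l : ℕ} (hl : A.lastCol k < l) :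
    A.entry k l = 0 := by
  rcases lt_or_ge (k + n) l with h | h
  · exact A.band k l h
  · have h2 := A.degCount_le k
    have h3 := A.numDeg_lt
    rw [lastCol_eq] at hl
    -- The column `l` lies on the diagonal of number `n - i`, with `i` a degeneration above `k`.
    let i : Fin A.numDeg := ⟨k + n - l, by omega⟩
    have hi : A.deg i < k := (A.lt_degCount_iff k i).1 (show k + n - l < A.degCount k by omega)
    have := A.diag_zero i k hi.le
    rwa [show k + (n - (i : ℕ)) = l from (show k + (n - (k + n - l)) = l by omega)] at this

/-- The regular row in which the column `m ≥ n` is the last one with a nonzero entry. -/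
noncomputable def regularRow (A : BandMatrix n) (m : ℕ) : ℕ := Nat.nth A.IsRegularRow (m - n)

theorem infinite_isRegularRow (A : BandMatrix n) : (Set.ofPred A.IsRegularRow).Infinite :=
  (Set.finite_range A.deg).infinite_compl

theorem isRegularRow_regularRow (A : BandMatrix n) (m : ℕ) :
    A.IsRegularRow (A.regularRow m) :=
  Nat.nth_mem_of_infinite A.infinite_isRegularRow _

theorem lastCol_regularRow (A : BandMatrix n) {m : ℕ} (hm : n ≤ m) :
    A.lastCol (A.regularRow m) = m := by
  rw [lastCol, regularRow, Nat.count_nth_of_infinite A.infinite_isRegularRow]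
  omega

theorem regularRow_lastCol (A : BandMatrix n) {k : ℕ} (hk : A.IsRegularRow k) :
    A.regularRow (A.lastCol k) = k := by
  rw [regularRow, lastCol, Nat.add_sub_cancel_left, Nat.nth_count hk]

theorem regularRow_lt (A : BandMatrix n) {m : ℕ} (hm : n ≤ m) : A.regularRow m < m := by
  conv_rhs => rw [← A.lastCol_regularRow hm]
  exact A.lt_lastCol _

theorem sum_row_eq (A : BandMatrix n) {R : Type*} [Semiring R] (ι : ℝ →+* R) (k : ℕ) {M : ℕ}
    (hM : A.lastCol k < M) (y : ℕ → R) :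
    ∑ l ∈ Finset.range M, ι (A.entry k l) * y l =
      ∑ l ∈ Finset.range (A.lastCol k), ι (A.entry k l) * y l +
        ι (A.entry k (A.lastCol k)) * y (A.lastCol k) := by
  rw [← Finset.sum_range_succ]
  refine (Finset.sum_subset (Finset.range_subset_range.2 hM) fun l _ hl => ?_).symm
  rw [Finset.mem_range, not_lt] at hl
  rw [A.entry_eq_zero_of_lastCol_lt hl, map_zero, zero_mul]

/-- The vector polynomials of `A`: the equation in the row `regularRow m` is solved for its last
unknown, of number `m`. -/
noncomputable def vectorPoly (A : BandMatrix n) (T : Matrix (Fin n) (Fin n) ℝ) (m : ℕ) :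
    Fin n → ℂ[X] := fun i =>
  if h : m < n then C (T i ⟨m, h⟩ : ℂ) else
    C ((A.entry (A.regularRow m) m : ℂ)⁻¹) * (X * vectorPoly A T (A.regularRow m) i -
      ∑ l : Fin m, C (A.entry (A.regularRow m) l : ℂ) * vectorPoly A T l i)
termination_by m
decreasing_by
  · exact A.regularRow_lt (not_lt.1 h)
  · exact l.2

theorem isVectorPolynomialSequence_vectorPoly (A : BandMatrix n)
    (T : Matrix (Fin n) (Fin n) ℝ) : A.IsVectorPolynomialSequence T (A.vectorPoly T) := by
  refine ⟨fun k i => ?_, fun k hk => ?_⟩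
  · rw [vectorPoly]
    simp
  · funext i
    have hk : A.IsRegularRow k := hk
    have hsum := A.sum_row_eq (Polynomial.C.comp Complex.ofRealHom) k
      (M := k + n + 1) (Nat.lt_succ_of_le (A.lastCol_le k)) (fun l => A.vectorPoly T l i)
    simp only [RingHom.comp_apply, Complex.ofRealHom_eq_coe] at hsum
    have hlast : A.vectorPoly T (A.lastCol k) i =
        C ((A.entry k (A.lastCol k) : ℂ)⁻¹) * (X * A.vectorPoly T k i -
          ∑ l ∈ Finset.range (A.lastCol k), C (A.entry k l : ℂ) * A.vectorPoly T l i) := by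
      rw [vectorPoly, dif_neg (by rw [lastCol]; omega), A.regularRow_lastCol hk,
        Finset.sum_range]
    have hne : (A.entry k (A.lastCol k) : ℂ) ≠ 0 :=
      Complex.ofReal_ne_zero.2 (A.entry_lastCol_pos hk).ne'
    rw [rowResidual, hsum, hlast, ← mul_assoc, ← C_mul, mul_inv_cancel₀ hne, C_1, one_mul]
    simp

/-! ### Generalized Fourier coefficients of eigenvectors -/

theorem eval_rowResidual (A : BandMatrix n) (p : ℕ → Fin n → ℂ[X]) (k : ℕ) (α : Fin n → ℂ)
    (z : ℂ) : ∑ j, α j * (A.rowResidual p k j).eval z =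
      z * ∑ j, α j * (p k j).eval z -
        ∑ l ∈ Finset.range (k + n + 1), (A.entry k l : ℂ) * ∑ j, α j * (p l j).eval z := by
  simp only [rowResidual, eval_sub, eval_mul, eval_X, eval_C, eval_finsetSum, mul_sub,
    Finset.sum_sub_distrib, Finset.mul_sum]
  congr 1
  · exact Finset.sum_congr rfl fun j _ => by ring
  · rw [Finset.sum_comm]
    exact Finset.sum_congr rfl fun l _ => Finset.sum_congr rfl fun j _ => by ring

/-- A solution of the regular rows of the eigenvector equation of a corner is determined by its
first `n` coordinates, hence is a combination of the components of the vector polynomials. -/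
theorem eq_sum_eval_of_recurrence (A : BandMatrix n) {T : Matrix (Fin n) (Fin n) ℝ}
    {p : ℕ → Fin n → ℂ[X]} (hp : A.IsVectorPolynomialSequence T p) {N : ℕ} {z : ℂ} {y : ℕ → ℂ}
    {α : Fin n → ℂ}
    (hy : ∀ k < N, ∑ l ∈ Finset.range N, (A.entry k l : ℂ) * y l = z * y k)
    (h0 : ∀ k < n, y k = ∑ j, α j * (p k j).eval z) :
    ∀ k < N, y k = ∑ j, α j * (p k j).eval z := by
  intro k
  induction k using Nat.strong_induction_on with
  | _ k ih =>
    intro hkN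
    rcases lt_or_ge k n with hk | hk
    · exact h0 k hk
    set r := A.regularRow k with hr
    have hrk : r < k := A.regularRow_lt hk
    have hcol : A.lastCol r = k := A.lastCol_regularRow hk
    have hreg : A.IsRegularRow r := A.isRegularRow_regularRow k
    have h1 := hy r (hrk.trans hkN)
    have h2 := A.eval_rowResidual p r α z
    rw [hp.2 r hreg] at h2
    have h3 := A.sum_row_eq Complex.ofRealHom r (M := N) (by rwa [hcol]) y
    have h4 := A.sum_row_eq Complex.ofRealHom r (M := r + n + 1)
      (Nat.lt_succ_of_le (A.lastCol_le r)) (fun l => ∑ j, α j * (p l j).eval z)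
    simp only [Complex.ofRealHom_eq_coe, hcol] at h3 h4
    rw [h3, ih r hrk (hrk.trans hkN)] at h1
    rw [h4] at h2
    simp only [Pi.zero_apply, eval_zero, mul_zero, Finset.sum_const_zero] at h2
    have h5 : ∑ l ∈ Finset.range k, (A.entry r l : ℂ) * y l =
        ∑ l ∈ Finset.range k, (A.entry r l : ℂ) * ∑ j, α j * (p l j).eval z :=
      Finset.sum_congr rfl fun l hl => by
        rw [ih l (Finset.mem_range.1 hl) ((Finset.mem_range.1 hl).trans hkN)]
    have hne : (A.entry r k : ℂ) ≠ 0 := by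
      rw [← hcol]
      exact Complex.ofReal_ne_zero.2 (A.entry_lastCol_pos hreg).ne'
    refine mul_left_cancel₀ hne ?_
    linear_combination h1 - h2 - h5

end BandMatrix

theorem IsInitialMatrix.isUnit_det {n : ℕ} {T : Matrix (Fin n) (Fin n) ℝ}
    (hT : IsInitialMatrix T) : IsUnit (T.map Complex.ofReal).det := by
  have h1 : T.BlockTriangular id := fun i j hij => hT.1 i j hij
  have h2 : T.det ≠ 0 := by
    rw [Matrix.det_of_isUpperTriangular h1]
    exact hT.2
  have h3 : (T.map Complex.ofReal).det = (T.det : ℂ) :=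
    (RingHom.map_det Complex.ofRealHom T).symm
  rw [h3, isUnit_iff_ne_zero]
  exact Complex.ofReal_ne_zero.2 h2

namespace BandMatrix

variable {n : ℕ}

/-- The spectral data of the upper-left `N × N` corner of `A`: an orthonormal basis of eigenvectors
`u l`, extended by zero to sequences, the eigenvalues `x l`, and the coefficients `α l` of the
eigenvectors in the components of the vector polynomials. Orthonormality is recorded in the form
of the completeness relations. -/
structure SectionData (A : BandMatrix n) (p : ℕ → Fin n → ℂ[X]) (N : ℕ) where
  /-- the eigenvectors -/
  u : Fin N → ℕ → ℂ
  /-- the eigenvalues -/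
  x : Fin N → ℝ
  /-- the coefficients of the eigenvectors -/
  α : Fin N → Fin n → ℂ
  completeness : ∀ j < N, ∀ k < N, ∑ l, conj (u l j) * u l k = if j = k then 1 else 0
  eigen : ∀ l, ∀ k < N, ∑ r ∈ Finset.range N, (A.entry k r : ℂ) * u l r = (x l : ℂ) * u l k
  decomp : ∀ l, ∀ k < N, u l k = ∑ j, α l j * (p k j).eval (x l : ℂ)

theorem IsSectionSpectralFunction.exists_sectionData {A : BandMatrix n} {p : ℕ → Fin n → ℂ[X]}
    {N : ℕ} {s : ℝ → Matrix (Fin n) (Fin n) ℂ} (h : A.IsSectionSpectralFunction p N s) :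
    ∃ D : A.SectionData p N, ∀ t : ℝ,
      s t = ∑ l with D.x l < t, Matrix.of fun a b => conj (D.α l a) * D.α l b := by
  obtain ⟨u, x, α, h1, h2, h3⟩ := h
  refine ⟨⟨fun l k => if hk : k < N then u l ⟨k, hk⟩ else 0, x, α, ?_, ?_, ?_⟩, h3⟩
  · intro j hj k hk
    have := u.sum_inner_mul_inner (EuclideanSpace.single ⟨k, hk⟩ (1 : ℂ))
      (EuclideanSpace.single ⟨j, hj⟩ (1 : ℂ))
    simp only [EuclideanSpace.inner_single_left, EuclideanSpace.inner_single_right, map_one,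
      one_mul] at this
    simp only [hj, hk, dif_pos]
    rw [Finset.sum_congr rfl fun l _ => mul_comm _ _, this]
    simp
  · intro l k hk
    rw [Finset.sum_range]
    simpa [hk] using h1 l ⟨k, hk⟩
  · intro l k hk
    simpa [hk] using h2 l ⟨k, hk⟩

theorem exists_isSectionSpectralFunction (A : BandMatrix n) {T : Matrix (Fin n) (Fin n) ℝ}
    (hT : IsInitialMatrix T) {p : ℕ → Fin n → ℂ[X]} (hp : A.IsVectorPolynomialSequence T p)
    {N : ℕ} (hN : n < N) : ∃ s, A.IsSectionSpectralFunction p N s := by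
  set M : Matrix (Fin N) (Fin N) ℂ := Matrix.of fun k r => (A.entry k r : ℂ) with hM
  have hMh : M.IsHermitian := by
    ext k r
    simp [hM, A.symm.apply]
  have heig : ∀ l k : Fin N, ∑ r : Fin N, (A.entry k r : ℂ) * hMh.eigenvectorBasis l r =
      (hMh.eigenvalues l : ℂ) * hMh.eigenvectorBasis l k := by
    intro l k
    simpa [Matrix.mulVec, dotProduct, hM] using
      congrFun (hMh.mulVec_eigenvectorBasis l) k
  set α : Fin N → Fin n → ℂ := fun l => Matrix.vecMul
    (fun i : Fin n => hMh.eigenvectorBasis l ⟨i, i.2.trans hN⟩) (T.map Complex.ofReal)⁻¹ with hα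
  refine ⟨_, hMh.eigenvectorBasis, hMh.eigenvalues, α, heig, fun l k => ?_, fun t => rfl⟩
  have := A.eq_sum_eval_of_recurrence hp (N := N) (z := hMh.eigenvalues l) (α := α l)
    (y := fun k => if hk : k < N then hMh.eigenvectorBasis l ⟨k, hk⟩ else 0) ?_ ?_ k k.2
  · simpa using this
  · intro k hk
    rw [Finset.sum_range]
    simpa [hk] using heig l ⟨k, hk⟩
  · intro k hk
    have h1 : Matrix.vecMul (α l) (T.map Complex.ofReal) =
        fun i : Fin n => hMh.eigenvectorBasis l ⟨i, i.2.trans hN⟩ := by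
      rw [hα, Matrix.vecMul_vecMul, Matrix.nonsing_inv_mul _ hT.isUnit_det, Matrix.vecMul_one]
    have h2 := congrFun h1 ⟨k, hk⟩
    rw [dif_pos (hk.trans hN), ← h2]
    simp only [Matrix.vecMul, dotProduct, Matrix.map_apply]
    refine Finset.sum_congr rfl fun j _ => ?_
    rw [hp.1 ⟨k, hk⟩ j, eval_C]

end BandMatrix

/-! ### Moments of the spectral functions of the corners -/

theorem eval_map_conj (P : ℂ[X]) (t : ℝ) :
    (P.map (starRingEnd ℂ)).eval (t : ℂ) = conj (P.eval (t : ℂ)) := by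
  conv_lhs => rw [← Complex.conj_ofReal t]
  exact eval_map_apply (starRingEnd ℂ) (t : ℂ)

namespace BandMatrix

variable {n : ℕ}

namespace SectionData

variable {A : BandMatrix n} {p : ℕ → Fin n → ℂ[X]} {N : ℕ}

/-- The mass `⟨v, (conj α_a α_b)_{a,b} v⟩` at the `l`-th eigenvalue. -/
noncomputable def weight (D : A.SectionData p N) (v : Fin n → ℂ) (l : Fin N) : ℝ :=
  ‖∑ b, D.α l b * v b‖ ^ 2

/-- The measure `⟨v, dσ_N v⟩`. -/
noncomputable def measure (D : A.SectionData p N) (v : Fin n → ℂ) : Measure ℝ :=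
  ∑ l, ENNReal.ofReal (D.weight v l) • Measure.dirac (D.x l)

/-- The `(a, b)` entry of `∫ P dσ_N`, for a polynomial `P`. -/
noncomputable def polyMoment (D : A.SectionData p N) (a b : Fin n) (P : ℂ[X]) : ℂ :=
  ∑ l, conj (D.α l a) * D.α l b * P.eval (D.x l : ℂ)

theorem weight_nonneg (D : A.SectionData p N) (v : Fin n → ℂ) (l : Fin N) : 0 ≤ D.weight v l :=
  sq_nonneg _

theorem coe_weight (D : A.SectionData p N) (v : Fin n → ℂ) (l : Fin N) :
    (D.weight v l : ℂ) = ∑ a, ∑ b, conj (v a) * v b * (conj (D.α l a) * D.α l b) := by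
  have h : (D.weight v l : ℂ) = conj (∑ a, D.α l a * v a) * ∑ b, D.α l b * v b := by
    rw [weight, ← Complex.normSq_eq_norm_sq, Complex.normSq_eq_conj_mul_self]
  rw [h, map_sum, Finset.sum_mul_sum]
  refine Finset.sum_congr rfl fun a _ => Finset.sum_congr rfl fun b _ => ?_
  rw [map_mul]
  ring

theorem sum_weight_mul_eval (D : A.SectionData p N) (v : Fin n → ℂ) (P : ℂ[X]) :
    ∑ l, (D.weight v l : ℂ) * P.eval (D.x l : ℂ) =
      ∑ a, ∑ b, conj (v a) * v b * D.polyMoment a b P := by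
  simp only [coe_weight, polyMoment, Finset.mul_sum, Finset.sum_mul]
  rw [Finset.sum_comm]
  refine Finset.sum_congr rfl fun a _ => ?_
  rw [Finset.sum_comm]
  exact Finset.sum_congr rfl fun b _ => Finset.sum_congr rfl fun l _ => by ring

theorem lintegral_measure (D : A.SectionData p N) (v : Fin n → ℂ) {f : ℝ → ℝ}
    (hf : ∀ t, 0 ≤ f t) :
    ∫⁻ t, ENNReal.ofReal (f t) ∂D.measure v =
      ENNReal.ofReal (∑ l, D.weight v l * f (D.x l)) := by
  rw [measure, lintegral_finsetSum_measure,
    ENNReal.ofReal_sum_of_nonneg fun l _ => mul_nonneg (D.weight_nonneg v l) (hf _)]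
  refine Finset.sum_congr rfl fun l _ => ?_
  rw [lintegral_smul_measure, lintegral_dirac, smul_eq_mul,
    ENNReal.ofReal_mul (D.weight_nonneg v l)]

theorem measure_Iio (D : A.SectionData p N) (v : Fin n → ℂ) (t : ℝ) :
    D.measure v (Set.Iio t) = ENNReal.ofReal (∑ l with D.x l < t, D.weight v l) := by
  rw [measure, Measure.finsetSum_apply, Finset.sum_filter, ENNReal.ofReal_sum_of_nonneg]
  · refine Finset.sum_congr rfl fun l _ => ?_
    by_cases h : D.x l < t <;> simp [h]
  · intro l _
    split_ifs
    exacts [D.weight_nonneg v l, le_rfl]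

theorem measure_univ (D : A.SectionData p N) (v : Fin n → ℂ) :
    D.measure v Set.univ = ENNReal.ofReal (∑ l, D.weight v l) := by
  simpa using D.lintegral_measure v (f := fun _ => 1) fun _ => zero_le_one

theorem integrable_measure (D : A.SectionData p N) (v : Fin n → ℂ) {E : Type*}
    [NormedAddCommGroup E] (f : ℝ → E) : Integrable f (D.measure v) :=
  integrable_finsetSum_measure.2 fun l _ =>
    (integrable_dirac (by simp)).smul_measure ENNReal.ofReal_ne_top

theorem integral_measure (D : A.SectionData p N) (v : Fin n → ℂ) {E : Type*}
    [NormedAddCommGroup E] [NormedSpace ℝ E] [CompleteSpace E] (f : ℝ → E) :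
    ∫ t, f t ∂D.measure v = ∑ l, D.weight v l • f (D.x l) := by
  rw [measure, integral_finsetSum_measure fun l _ =>
    (integrable_dirac (by simp)).smul_measure ENNReal.ofReal_ne_top]
  refine Finset.sum_congr rfl fun l _ => ?_
  rw [integral_smul_measure, integral_dirac, ENNReal.toReal_ofReal (D.weight_nonneg v l)]

/-- Multiplying by the eigenvalue amounts to applying the band matrix, so that `x^k α_i` is a
combination of finitely many coordinates of the eigenvector, with coefficients (those of the row
`e_i T⁻¹ A^k`) that do not depend on the size of the corner. -/
theorem exists_pow_mul_α_eq {T : Matrix (Fin n) (Fin n) ℝ} (hT : IsInitialMatrix T)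
    (hp : A.IsVectorPolynomialSequence T p) (k : ℕ) (i : Fin n) :
    ∃ c : ℕ → ℂ, ∀ N, n + k * n < N → ∀ (D : A.SectionData p N) (l : Fin N),
      (D.x l : ℂ) ^ k * D.α l i = ∑ r ∈ Finset.range (n + k * n), c r * D.u l r := by
  induction k with
  | zero =>
    refine ⟨fun r => if h : r < n then (T.map Complex.ofReal)⁻¹ ⟨r, h⟩ i else 0,
      fun N hN D l => ?_⟩
    rw [zero_mul, add_zero] at hN ⊢
    have h1 : Matrix.vecMul (D.α l) (T.map Complex.ofReal) = fun r : Fin n => D.u l r := by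
      funext r
      rw [D.decomp l r (r.2.trans hN)]
      simp only [hp.1, eval_C, Matrix.vecMul, dotProduct, Matrix.map_apply]
    have h2 := congrArg (fun w => Matrix.vecMul w (T.map Complex.ofReal)⁻¹ i) h1
    simp only [Matrix.vecMul_vecMul, Matrix.mul_nonsing_inv _ hT.isUnit_det,
      Matrix.vecMul_one] at h2
    rw [pow_zero, one_mul, h2, Finset.sum_range]
    simp [Matrix.vecMul, dotProduct, mul_comm]
  | succ k ih =>
    obtain ⟨c, hc⟩ := ih
    refine ⟨fun s => ∑ r ∈ Finset.range (n + k * n), c r * A.entry r s, fun N hN D l => ?_⟩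
    have hM : n + (k + 1) * n = n + k * n + n := by ring
    rw [hM] at hN ⊢
    have h1 : ∀ r ∈ Finset.range (n + k * n), (D.x l : ℂ) * D.u l r =
        ∑ s ∈ Finset.range (n + k * n + n), (A.entry r s : ℂ) * D.u l s := by
      intro r hr
      rw [Finset.mem_range] at hr
      rw [← D.eigen l r (by omega)]
      refine (Finset.sum_subset (Finset.range_subset_range.2 hN.le) fun s _ hs => ?_).symm
      rw [Finset.mem_range, not_lt] at hs
      rw [A.band r s (by omega), Complex.ofReal_zero, zero_mul]
    calc (D.x l : ℂ) ^ (k + 1) * D.α l i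
        = ∑ r ∈ Finset.range (n + k * n), c r * (D.x l * D.u l r) := by
          rw [pow_succ', mul_assoc, hc N (by omega) D l, Finset.mul_sum]
          exact Finset.sum_congr rfl fun r _ => by ring
      _ = ∑ r ∈ Finset.range (n + k * n), ∑ s ∈ Finset.range (n + k * n + n),
            c r * A.entry r s * D.u l s := by
          refine Finset.sum_congr rfl fun r hr => ?_
          rw [h1 r hr, Finset.mul_sum]
          exact Finset.sum_congr rfl fun s _ => by ring
      _ = _ := by
          rw [Finset.sum_comm]
          simp only [Finset.sum_mul]

/-- The `k`-th moment of `σ_N` does not depend on `N > n + k n`. -/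
theorem exists_polyMoment_X_pow_eq {T : Matrix (Fin n) (Fin n) ℝ} (hT : IsInitialMatrix T)
    (hp : A.IsVectorPolynomialSequence T p) (k : ℕ) (a b : Fin n) :
    ∃ c : ℂ, ∀ N, n + k * n < N → ∀ D : A.SectionData p N, D.polyMoment a b (X ^ k) = c := by
  obtain ⟨c₀, h₀⟩ := exists_pow_mul_α_eq hT hp 0 a
  obtain ⟨c₁, h₁⟩ := exists_pow_mul_α_eq hT hp k b
  refine ⟨∑ r ∈ Finset.range n, ∑ s ∈ Finset.range (n + k * n),
    conj (c₀ r) * c₁ s * if r = s then 1 else 0, fun N hN D => ?_⟩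
  have hnN : n < N := by omega
  simp only [zero_mul, add_zero, pow_zero, one_mul] at h₀
  have h2 : ∀ l, conj (D.α l a) * D.α l b * (X ^ k : ℂ[X]).eval (D.x l : ℂ) =
      ∑ r ∈ Finset.range n, ∑ s ∈ Finset.range (n + k * n),
        conj (c₀ r) * c₁ s * (conj (D.u l r) * D.u l s) := by
    intro l
    rw [eval_pow, eval_X, mul_assoc, mul_comm (D.α l b), h₁ N hN D l, h₀ N hnN D l, map_sum,
      Finset.sum_mul_sum]
    refine Finset.sum_congr rfl fun r _ => Finset.sum_congr rfl fun s _ => ?_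
    rw [map_mul]
    ring
  rw [polyMoment, Finset.sum_congr rfl fun l _ => h2 l, Finset.sum_comm]
  refine Finset.sum_congr rfl fun r hr => ?_
  rw [Finset.sum_comm]
  refine Finset.sum_congr rfl fun s hs => ?_
  rw [← Finset.mul_sum, D.completeness r ((Finset.mem_range.1 hr).trans hnN) s
    ((Finset.mem_range.1 hs).trans hN)]

theorem exists_eventually_polyMoment_eq {T : Matrix (Fin n) (Fin n) ℝ}
    (hT : IsInitialMatrix T) (hp : A.IsVectorPolynomialSequence T p) (P : ℂ[X]) (a b : Fin n) :
    ∃ c : ℂ, ∀ᶠ N in atTop, ∀ D : A.SectionData p N, D.polyMoment a b P = c := by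
  induction P using Polynomial.induction_on' with
  | add P Q hP hQ =>
    obtain ⟨c, hc⟩ := hP
    obtain ⟨d, hd⟩ := hQ
    refine ⟨c + d, ?_⟩
    filter_upwards [hc, hd] with N h1 h2 D
    rw [← h1 D, ← h2 D]
    simp only [polyMoment, eval_add, mul_add, Finset.sum_add_distrib]
  | monomial k z =>
    obtain ⟨c, hc⟩ := exists_polyMoment_X_pow_eq hT hp k a b
    refine ⟨z * c, ?_⟩
    filter_upwards [eventually_gt_atTop (n + k * n)] with N hN D
    rw [← hc N hN D]
    simp only [polyMoment, eval_monomial, eval_pow, eval_X, Finset.mul_sum]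
    exact Finset.sum_congr rfl fun l _ => by ring

theorem exists_sum_weight_eq {T : Matrix (Fin n) (Fin n) ℝ}
    (hT : IsInitialMatrix T) (hp : A.IsVectorPolynomialSequence T p) (v : Fin n → ℂ) :
    ∃ m : ℝ, ∀ N, n < N → ∀ D : A.SectionData p N, ∑ l, D.weight v l = m := by
  choose c hc using exists_polyMoment_X_pow_eq hT hp 0
  refine ⟨(∑ a, ∑ b, conj (v a) * v b * c a b).re, fun N hN D => ?_⟩
  have h := D.sum_weight_mul_eval v (X ^ 0)
  simp only [hc _ _ N (by omega) D] at h
  rw [← h]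
  simp

theorem exists_lintegral_measure_le {T : Matrix (Fin n) (Fin n) ℝ}
    (hT : IsInitialMatrix T) (hp : A.IsVectorPolynomialSequence T p) (v : Fin n → ℂ) (k : ℕ) :
    ∃ C : ENNReal, C ≠ ⊤ ∧ ∀ᶠ N in atTop, ∀ D : A.SectionData p N,
      ∫⁻ t, ENNReal.ofReal ((1 + t ^ 2) ^ k) ∂D.measure v ≤ C := by
  choose c hc using exists_eventually_polyMoment_eq hT hp ((1 + X ^ 2) ^ k)
  refine ⟨ENNReal.ofReal (∑ a, ∑ b, conj (v a) * v b * c a b).re, ENNReal.ofReal_ne_top, ?_⟩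
  filter_upwards [eventually_all.2 fun a => eventually_all.2 fun b => hc a b] with N hN D
  have h := D.sum_weight_mul_eval v ((1 + X ^ 2) ^ k)
  simp only [hN _ _ D] at h
  rw [lintegral_measure _ _ fun t => by positivity, ← h]
  refine (congrArg ENNReal.ofReal ?_).le
  rw [Complex.re_sum]
  refine Finset.sum_congr rfl fun l _ => ?_
  rw [Complex.re_ofReal_mul]
  congr 1
  have : eval (D.x l : ℂ) ((1 + X ^ 2) ^ k) = (((1 + D.x l ^ 2) ^ k : ℝ) : ℂ) := by
    push_cast
    simp
  rw [this, Complex.ofReal_re]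

/-- The inner product of vector polynomials with respect to `σ_N`. -/
theorem sum_polyMoment (D : A.SectionData p N) (f g : Fin n → ℂ[X]) :
    ∑ a, ∑ b, D.polyMoment a b ((f a).map (starRingEnd ℂ) * g b) =
      ∑ l, conj (∑ a, D.α l a * (f a).eval (D.x l : ℂ)) *
        ∑ b, D.α l b * (g b).eval (D.x l : ℂ) := by
  simp only [polyMoment, eval_mul, eval_map_conj, map_sum, Finset.sum_mul_sum, map_mul]
  symm
  rw [Finset.sum_comm]
  refine Finset.sum_congr rfl fun a _ => ?_
  rw [Finset.sum_comm]
  exact Finset.sum_congr rfl fun b _ => Finset.sum_congr rfl fun l _ => by ring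

end SectionData

end BandMatrix

/-! ### The limit is a spectral function -/

/-- Polarization of `conj α_i α_j`, with the vectors that `MonotoneMatrixFunction.entryIntegral` uses. -/
theorem polarization_single {n : ℕ} (α : Fin n → ℂ) (i j : Fin n) :
    (1 / 4 : ℂ) * ∑ r : Fin 4, (-Complex.I) ^ (r : ℕ) *
      ((‖∑ b, α b * (Pi.single i 1 + Complex.I ^ (r : ℕ) • Pi.single j 1 : Fin n → ℂ) b‖ ^ 2 : ℝ)
        : ℂ) = conj (α i) * α j := by
  have h : ∀ r : Fin 4,
      ∑ b, α b * (Pi.single i 1 + Complex.I ^ (r : ℕ) • Pi.single j 1 : Fin n → ℂ) b =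
        α i + Complex.I ^ (r : ℕ) * α j := by
    intro r
    simp [mul_add, Finset.sum_add_distrib, Pi.single_apply, mul_comm]
  simp only [h, ← Complex.normSq_eq_norm_sq, Complex.normSq_eq_conj_mul_self, map_add, map_mul,
    map_pow, Complex.conj_I, Fin.sum_univ_four]
  norm_num [pow_succ]
  ring_nf
  simp only [Complex.I_sq]
  ring_nf

namespace BandMatrix

variable {n : ℕ}

/-- The vectors `e_i + i^r e_j` of the polarization identity. -/
noncomputable def polVec (x : Fin n × Fin n × Fin 4) : Fin n → ℂ :=
  Pi.single x.1 1 + Complex.I ^ (x.2.2 : ℕ) • Pi.single x.2.1 1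

namespace SectionData

variable {A : BandMatrix n} {p : ℕ → Fin n → ℂ[X]} {N : ℕ}

theorem polarization_weight (D : A.SectionData p N) (l : Fin N) (i j : Fin n) :
    (1 / 4 : ℂ) * ∑ r : Fin 4, (-Complex.I) ^ (r : ℕ) * (D.weight (polVec (i, j, r)) l : ℂ) =
      conj (D.α l i) * D.α l j :=
  polarization_single (D.α l) i j

theorem dotProduct_sum_mulVec (D : A.SectionData p N) (v : Fin n → ℂ) (s : Finset (Fin N)) :
    star v ⬝ᵥ (∑ l ∈ s, Matrix.of fun a b => conj (D.α l a) * D.α l b).mulVec v =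
      ((∑ l ∈ s, D.weight v l : ℝ) : ℂ) := by
  simp only [Complex.ofReal_sum, coe_weight, dotProduct, Matrix.mulVec, Matrix.sum_apply,
    Matrix.of_apply, Finset.mul_sum, Finset.sum_mul, Pi.star_apply, RCLike.star_def]
  symm
  rw [Finset.sum_comm]
  refine Finset.sum_congr rfl fun a _ => ?_
  rw [Finset.sum_comm]
  exact Finset.sum_congr rfl fun b _ => Finset.sum_congr rfl fun l _ => by ring

theorem sum_apply_eq_polarization (D : A.SectionData p N) (s : Finset (Fin N)) (i j : Fin n) :
    (∑ l ∈ s, Matrix.of fun a b => conj (D.α l a) * D.α l b) i j =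
      (1 / 4 : ℂ) * ∑ r : Fin 4, (-Complex.I) ^ (r : ℕ) *
        ((∑ l ∈ s, D.weight (polVec (i, j, r)) l : ℝ) : ℂ) := by
  simp only [Matrix.sum_apply, Matrix.of_apply, ← polarization_weight, Complex.ofReal_sum,
    Finset.mul_sum]
  exact Finset.sum_comm

theorem polyMoment_eq_polarization (D : A.SectionData p N) (P : ℂ[X]) (i j : Fin n) :
    D.polyMoment i j P = (1 / 4 : ℂ) * ∑ r : Fin 4, (-Complex.I) ^ (r : ℕ) *
        ∫ t : ℝ, P.eval (t : ℂ) ∂D.measure (polVec (i, j, r)) := by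
  simp only [polyMoment, ← polarization_weight, integral_measure, Finset.mul_sum, Finset.sum_mul,
    Complex.real_smul]
  rw [Finset.sum_comm]
  exact Finset.sum_congr rfl fun r _ => Finset.sum_congr rfl fun l _ => by ring

end SectionData

open SectionData

/-- Helly's theorem for the spectral functions of the corners. -/
theorem exists_subseq_tendsto_monotoneMatrixFunction {A : BandMatrix n}
    {T : Matrix (Fin n) (Fin n) ℝ} (hT : IsInitialMatrix T) {p : ℕ → Fin n → ℂ[X]}
    (hp : A.IsVectorPolynomialSequence T p) (M : ℕ → ℕ) (hM : ∀ k, n < M k)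
    (D : ∀ k, A.SectionData p (M k)) :
    ∃ (φ : ℕ → ℕ) (σ : MonotoneMatrixFunction n), StrictMono φ ∧
      ∀ t, Tendsto (fun k => ∑ l with (D (φ k)).x l < t,
        Matrix.of fun a b => conj ((D (φ k)).α l a) * (D (φ k)).α l b) atTop
          (𝓝 (σ.toFun t)) := by
  choose m hm using fun v => exists_sum_weight_eq (A := A) hT hp v
  have hm0 : ∀ v, 0 ≤ m v := fun v => by
    rw [← hm v _ (hM 0) (D 0)]
    exact Finset.sum_nonneg fun l _ => weight_nonneg _ _ _
  obtain ⟨φ, G, hφ, hG⟩ := exists_subseq_tendsto_of_monotone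
    (fun k (i : Fin n × Fin n × Fin 4) t => ∑ l with (D k).x l < t, (D k).weight (polVec i) l)
    (fun k i s t hst => Finset.sum_le_sum_of_subset_of_nonneg
      (Finset.monotone_filter_right _ fun l _ hl => hl.trans_le hst)
      fun l _ _ => weight_nonneg _ _ _)
    (∑ i, m (polVec i)) (fun k i t => by
      refine ⟨Finset.sum_nonneg fun l _ => weight_nonneg _ _ _, ?_⟩
      calc _ ≤ ∑ l, (D k).weight (polVec i) l := Finset.sum_le_sum_of_subset_of_nonneg
              (Finset.filter_subset _ _) fun l _ _ => weight_nonneg _ _ _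
        _ = m (polVec i) := hm _ _ (hM k) (D k)
        _ ≤ _ := Finset.single_le_sum (f := fun i => m (polVec i)) (fun i _ => hm0 _)
              (Finset.mem_univ i))
  set σ : ℝ → Matrix (Fin n) (Fin n) ℂ := fun t => Matrix.of fun i j =>
    (1 / 4 : ℂ) * ∑ r : Fin 4, (-Complex.I) ^ (r : ℕ) * (G (i, j, r) t : ℂ) with hσ
  have hlim : ∀ t, Tendsto (fun k => ∑ l with (D (φ k)).x l < t,
      Matrix.of fun a b => conj ((D (φ k)).α l a) * (D (φ k)).α l b) atTop (𝓝 (σ t)) := by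
    intro t
    refine tendsto_pi_nhds.2 fun i => tendsto_pi_nhds.2 fun j => ?_
    simp only [sum_apply_eq_polarization]
    exact (tendsto_finsetSum _ fun r _ => (Complex.continuous_ofReal.continuousAt.tendsto.comp
      (hG (i, j, r) t)).const_mul _).const_mul _
  have hherm : ∀ t, (σ t).IsHermitian := by
    intro t
    refine tendsto_nhds_unique ((continuous_id.matrix_conjTranspose.tendsto _).comp (hlim t))
      ((hlim t).congr fun k => ?_)
    ext a b
    simp [Matrix.sum_apply, mul_comm]
  refine ⟨φ, ⟨σ, hherm, fun s t hst => ?_⟩, hφ, hlim⟩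
  refine Matrix.PosSemidef.of_dotProduct_mulVec_nonneg ((hherm t).sub (hherm s)) fun v => ?_
  have hcont : Continuous fun B : Matrix (Fin n) (Fin n) ℂ => star v ⬝ᵥ B.mulVec v := by
    fun_prop
  refine ge_of_tendsto ((hcont.tendsto _).comp ((hlim t).sub (hlim s)))
    (Eventually.of_forall fun k => ?_)
  simp only [Function.comp_apply, Matrix.sub_mulVec, dotProduct_sub, dotProduct_sum_mulVec]
  rw [← Complex.ofReal_sub, Complex.zero_le_real, sub_nonneg]
  exact Finset.sum_le_sum_of_subset_of_nonneg
      (Finset.monotone_filter_right _ fun l _ hl => hl.trans_le hst)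
      fun l _ _ => weight_nonneg _ _ _

section Limit

variable {A : BandMatrix n} {T : Matrix (Fin n) (Fin n) ℝ} {p : ℕ → Fin n → ℂ[X]} {M : ℕ → ℕ}
  {D : ∀ k, A.SectionData p (M k)} {σ : MonotoneMatrixFunction n}

theorem integrable_and_tendsto_integral_pow (hT : IsInitialMatrix T)
    (hp : A.IsVectorPolynomialSequence T p) (hM : ∀ k, n < M k) (hMtop : Tendsto M atTop atTop)
    (hlim : ∀ t, Tendsto (fun k => ∑ l with (D k).x l < t,
      Matrix.of fun a b => conj ((D k).α l a) * (D k).α l b) atTop (𝓝 (σ.toFun t)))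
    (v : Fin n → ℂ) (k : ℕ) :
    Integrable (fun t : ℝ => t ^ k) (σ.quadMeasure v) ∧
      Tendsto (fun N => ∫ t, t ^ k ∂(D N).measure v) atTop
        (𝓝 (∫ t, t ^ k ∂σ.quadMeasure v)) := by
  obtain ⟨m, hm⟩ := exists_sum_weight_eq hT hp v
  have hcont : Continuous fun B : Matrix (Fin n) (Fin n) ℂ => (star v ⬝ᵥ B.mulVec v).re := by
    fun_prop
  have hquad : ∀ t, Tendsto (fun N => ∑ l with (D N).x l < t, (D N).weight v l) atTop
      (𝓝 (σ.quadForm v t)) := fun t => by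
    refine ((hcont.tendsto _).comp (hlim t)).congr fun N => ?_
    rw [Function.comp_apply, dotProduct_sum_mulVec, Complex.ofReal_re]
  refine tendsto_moment_stieltjes (σ.monotone_quadForm v)
    (fun t => ge_of_tendsto' (hquad t) fun N => Finset.sum_nonneg fun l _ => weight_nonneg _ _ _)
    (fun t => ?_) (m := m) ?_ (fun N => ?_) (fun k => ?_) k
  · simp only [measure_Iio]
    exact (ENNReal.continuous_ofReal.tendsto _).comp (hquad t)
  · rw [← hm _ (hM 0) (D 0)]
    exact Finset.sum_nonneg fun l _ => weight_nonneg _ _ _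
  · rw [measure_univ, hm _ (hM N) (D N)]
  · obtain ⟨C, hC, h⟩ := exists_lintegral_measure_le hT hp v k
    exact ⟨C, hC, (hMtop.eventually h).mono fun N hN => hN (D N)⟩

theorem integrable_and_tendsto_integral_eval (hT : IsInitialMatrix T)
    (hp : A.IsVectorPolynomialSequence T p) (hM : ∀ k, n < M k) (hMtop : Tendsto M atTop atTop)
    (hlim : ∀ t, Tendsto (fun k => ∑ l with (D k).x l < t,
      Matrix.of fun a b => conj ((D k).α l a) * (D k).α l b) atTop (𝓝 (σ.toFun t)))
    (v : Fin n → ℂ) (P : ℂ[X]) :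
    Integrable (fun t : ℝ => P.eval (t : ℂ)) (σ.quadMeasure v) ∧
      Tendsto (fun N => ∫ t : ℝ, P.eval (t : ℂ) ∂(D N).measure v) atTop
        (𝓝 (∫ t : ℝ, P.eval (t : ℂ) ∂σ.quadMeasure v)) := by
  induction P using Polynomial.induction_on' with
  | add P Q hP hQ =>
    simp only [eval_add]
    refine ⟨hP.1.add hQ.1, ?_⟩
    rw [integral_add hP.1 hQ.1]
    refine (hP.2.add hQ.2).congr fun N => ?_
    rw [integral_add (integrable_measure _ _ _) (integrable_measure _ _ _)]
  | monomial k z =>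
    obtain ⟨h1, h2⟩ := integrable_and_tendsto_integral_pow hT hp hM hMtop hlim v k
    simp only [eval_monomial, ← Complex.ofReal_pow]
    refine ⟨h1.ofReal.const_mul z, ?_⟩
    simp only [integral_const_mul, integral_complex_ofReal]
    exact ((Complex.continuous_ofReal.tendsto _).comp h2).const_mul z

theorem tendsto_polyMoment (hT : IsInitialMatrix T)
    (hp : A.IsVectorPolynomialSequence T p) (hM : ∀ k, n < M k) (hMtop : Tendsto M atTop atTop)
    (hlim : ∀ t, Tendsto (fun k => ∑ l with (D k).x l < t,
      Matrix.of fun a b => conj ((D k).α l a) * (D k).α l b) atTop (𝓝 (σ.toFun t)))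
    (a b : Fin n) (P : ℂ[X]) :
    Tendsto (fun N => (D N).polyMoment a b P) atTop
      (𝓝 (σ.entryIntegral a b fun t => P.eval (t : ℂ))) := by
  simp only [polyMoment_eq_polarization]
  exact (tendsto_finsetSum _ fun r _ =>
    (integrable_and_tendsto_integral_eval hT hp hM hMtop hlim (polVec (a, b, r)) P).2.const_mul
      _).const_mul _

theorem tendsto_polyInner (hT : IsInitialMatrix T)
    (hp : A.IsVectorPolynomialSequence T p) (hM : ∀ k, n < M k) (hMtop : Tendsto M atTop atTop)
    (hlim : ∀ t, Tendsto (fun k => ∑ l with (D k).x l < t,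
      Matrix.of fun a b => conj ((D k).α l a) * (D k).α l b) atTop (𝓝 (σ.toFun t)))
    (f g : Fin n → ℂ[X]) :
    Tendsto (fun N => ∑ l, conj (∑ a, (D N).α l a * (f a).eval ((D N).x l : ℂ)) *
        ∑ b, (D N).α l b * (g b).eval ((D N).x l : ℂ)) atTop (𝓝 (σ.polyInner f g)) := by
  simp only [← sum_polyMoment]
  have h : σ.polyInner f g = ∑ a, ∑ b, σ.entryIntegral a b fun t =>
      ((f a).map (starRingEnd ℂ) * g b).eval (t : ℂ) := by
    simp only [MonotoneMatrixFunction.polyInner, eval_mul, eval_map_conj]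
  rw [h]
  exact tendsto_finsetSum _ fun a _ => tendsto_finsetSum _ fun b _ =>
    tendsto_polyMoment hT hp hM hMtop hlim a b _

/-- A pointwise limit of spectral functions of corners of growing size is a spectral function:
on the corner of size `N` the coefficient map `f ↦ ∑_a α_a f_a(x)` sends `𝒑_k` to the `k`-th
coordinates of the eigenvectors for `k < N`, and `𝒒_j` to zero once the row of `𝒒_j` fits. -/
theorem isSpectralFunctionFor_of_tendsto (hT : IsInitialMatrix T)
    (hp : A.IsVectorPolynomialSequence T p) (hM : ∀ k, n < M k) (hMtop : Tendsto M atTop atTop)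
    (hlim : ∀ t, Tendsto (fun k => ∑ l with (D k).x l < t,
      Matrix.of fun a b => conj ((D k).α l a) * (D k).α l b) atTop (𝓝 (σ.toFun t))) :
    A.IsSpectralFunctionFor p σ := by
  have horth : ∀ j k, σ.polyInner (p j) (p k) = if j = k then 1 else 0 := by
    intro j k
    refine tendsto_nhds_unique (tendsto_polyInner hT hp hM hMtop hlim (p j) (p k))
      (tendsto_const_nhds.congr' ?_)
    filter_upwards [hMtop.eventually (eventually_gt_atTop j),
      hMtop.eventually (eventually_gt_atTop k)] with N hj hk
    rw [← (D N).completeness j hj k hk]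
    exact Finset.sum_congr rfl fun l _ => by
      rw [← (D N).decomp l j hj, ← (D N).decomp l k hk]
  refine ⟨fun k v => (integrable_and_tendsto_integral_pow hT hp hM hMtop hlim v k).1, ?_, horth,
    fun j => ?_⟩
  · -- Orthonormality of the constant `𝒑_k = T e_k` reads `Tᵀ (∫ dσ) T = 1`.
    set B := T.map Complex.ofReal
    have h : B.transpose * (σ.moment 0 * B) = 1 := by
      ext j k
      have h1 : ∀ a b, (σ.entryIntegral a b fun t : ℝ =>
          conj ((p j a).eval (t : ℂ)) * (p k b).eval (t : ℂ)) =
            T a j * (σ.moment 0 a b * T b k) := by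
        intro a b
        simp only [hp.1, eval_C, Complex.conj_ofReal, MonotoneMatrixFunction.moment,
          Matrix.of_apply, pow_zero, MonotoneMatrixFunction.entryIntegral, integral_const,
          Complex.real_smul, Finset.mul_sum, Finset.sum_mul]
        exact Finset.sum_congr rfl fun r _ => by ring
      have h2 := horth j k
      simp only [MonotoneMatrixFunction.polyInner, h1] at h2
      simp only [Matrix.mul_apply, Matrix.transpose_apply, Matrix.one_apply, Finset.mul_sum]
      simpa [B, Fin.val_inj] using h2
    have hB : IsUnit B := (Matrix.isUnit_iff_isUnit_det _).2 hT.isUnit_det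
    have hdet := congrArg Matrix.det h
    rw [Matrix.det_mul, Matrix.det_mul, Matrix.det_one] at hdet
    rw [Matrix.isUnit_iff_isUnit_det, isUnit_iff_ne_zero]
    rintro h0
    simp [h0] at hdet
  · refine tendsto_nhds_unique (tendsto_polyInner hT hp hM hMtop hlim _ _)
      (tendsto_const_nhds.congr' ?_)
    filter_upwards [hMtop.eventually (eventually_gt_atTop (A.deg j + n))] with N hN
    refine (Finset.sum_eq_zero fun l _ => ?_).symm
    have h0 : ∑ b, (D N).α l b * (A.q p j b).eval ((D N).x l : ℂ) = 0 := by
      rw [q, eval_rowResidual, ← (D N).decomp l _ (by omega), ← (D N).eigen l _ (by omega),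
        sub_eq_zero]
      have h1 : ∀ r ∈ Finset.range (A.deg j + n + 1), (A.entry (A.deg j) r : ℂ) *
          ∑ b, (D N).α l b * (p r b).eval ((D N).x l : ℂ) =
            (A.entry (A.deg j) r : ℂ) * (D N).u l r := fun r hr => by
        rw [(D N).decomp l r (by rw [Finset.mem_range] at hr; omega)]
      rw [Finset.sum_congr rfl h1]
      refine (Finset.sum_subset (Finset.range_subset_range.2 (by omega)) fun s _ hs => ?_).symm
      rw [Finset.mem_range, not_lt] at hs
      rw [A.band _ s (by omega), Complex.ofReal_zero, zero_mul]
    rw [h0, mul_zero]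

end Limit

/-- For given initial data, every choice of spectral functions of the corners has a subsequence
converging pointwise to a spectral function. -/
theorem exists_subseq_tendsto_isSpectralFunctionFor (A : BandMatrix n)
    {T : Matrix (Fin n) (Fin n) ℝ} (hT : IsInitialMatrix T) {p : ℕ → Fin n → ℂ[X]}
    (hp : A.IsVectorPolynomialSequence T p) (S : ℕ → ℝ → Matrix (Fin n) (Fin n) ℂ)
    (hS : ∀ N, n < N → A.IsSectionSpectralFunction p N (S N)) :
    ∃ (N : ℕ → ℕ) (σ : MonotoneMatrixFunction n), StrictMono N ∧ (∀ i, n < N i) ∧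
      (∀ t, Tendsto (fun i => S (N i) t) atTop (𝓝 (σ.toFun t))) ∧
        A.IsSpectralFunctionFor p σ := by
  have hM : ∀ k, n < n + 1 + k := fun k => by omega
  choose D hD using fun k => (hS _ (hM k)).exists_sectionData
  obtain ⟨φ, σ, hφ, hlim⟩ := exists_subseq_tendsto_monotoneMatrixFunction hT hp _ hM D
  have hmono : StrictMono fun i => n + 1 + φ i := hφ.const_add (n + 1)
  refine ⟨fun i => n + 1 + φ i, σ, hmono, fun i => hM _, fun t => ?_,
    isSpectralFunctionFor_of_tendsto (M := fun i => n + 1 + φ i) (D := fun i => D (φ i)) hT hp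
      (fun i => hM _) hmono.tendsto_atTop hlim⟩
  simp only [hD]
  exact hlim t

end BandMatrix

theorem lemma3 (n : ℕ) (A : BandMatrix n) :
    (∃ σ : MonotoneMatrixFunction n, A.IsSpectralFunction σ) ∧
    ∀ T : Matrix (Fin n) (Fin n) ℝ, IsInitialMatrix T →
      ∃ p : ℕ → Fin n → ℂ[X], A.IsVectorPolynomialSequence T p ∧
        (∀ N, n < N → ∃ s, A.IsSectionSpectralFunction p N s) ∧
        ∀ S : ℕ → ℝ → Matrix (Fin n) (Fin n) ℂ,
          (∀ N, n < N → A.IsSectionSpectralFunction p N (S N)) →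
          ∃ (N : ℕ → ℕ) (σ : MonotoneMatrixFunction n),
            StrictMono N ∧ (∀ i, n < N i) ∧
            (∀ t, Tendsto (fun i => S (N i) t) atTop (𝓝 (σ.toFun t))) ∧
            A.IsSpectralFunctionFor p σ := by
  constructor
  · have hT : IsInitialMatrix (1 : Matrix (Fin n) (Fin n) ℝ) :=
      ⟨fun i j hij => Matrix.one_apply_ne hij.ne', by simp⟩
    have hp := A.isVectorPolynomialSequence_vectorPoly 1
    have hex : ∀ N, ∃ s, n < N → A.IsSectionSpectralFunction (A.vectorPoly 1) N s := fun N => by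
      by_cases hN : n < N
      · exact (A.exists_isSectionSpectralFunction hT hp hN).imp fun s hs _ => hs
      · exact ⟨0, fun h => absurd h hN⟩
    choose S hS using hex
    obtain ⟨-, σ, -, -, -, hσ⟩ := A.exists_subseq_tendsto_isSpectralFunctionFor hT hp S hS
    exact ⟨σ, 1, hT, _, hp, hσ⟩
  · intro T hT
    have hp := A.isVectorPolynomialSequence_vectorPoly T
    exact ⟨_, hp, fun N hN => A.exists_isSectionSpectralFunction hT hp hN,
      A.exists_subseq_tendsto_isSpectralFunctionFor hT hp⟩
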